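/- Let $\mu>1$ and $b>0$. The (planar) anisotropic Manev problem is the Hamiltonian system $\dot{\bf q}={\bf p}$, $\dot{\bf p}=-\partial H/\partial{\bf q}$ on $(\mathbb R^2\setminus\{0\})\times\mathbb R^2$, where ${\bf q}=(x,y)$, ${\bf p}=(p_x,p_y)$ and $$H({\bf q},{\bf p})=\tfrac12(p_x^2+p_y^2)-\frac{1}{\sqrt{x^2+\mu y^2}}-\frac{b}{x^2+\mu y^2}.$$ Then for every $T>0$ and every integer $n$ of the form $n=4k+1$, $k\in\mathbb Z$, the problem has at least one (collision-free, classical) periodic solution $({\bf q},{\bf p}):\mathbb R\to(\mathbb R^2\setminus\{0\})\times\mathbb R^2$ of period $T$ (not necessarily the minimal period) with the following two properties. It is $S_3$-symmetric, that is, the map $S_3:(x,y,p_x,p_y)\mapsto(-x,-y,-p_x,-p_y)$, which leaves time unchanged, carries the orbit to itself with a time shift of half a period: ${\bf q}(t+T/2)=-{\bf q}(t)$ and ${\bf p}(t+T/2)=-{\bf p}(t)$ for all $t$. And it has winding number $n$: the closed curve ${\bf q}(t)$, $0\le t\le T$, winds $n$ times around the origin, counted positively counterclockwise. -/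

import Mathlib

/-- A point of the phase space of the planar problem: position `(x, y)`, momentum `(px, py)`. -/
@[ext]
structure PhasePoint where
  x : ℝ
  y : ℝ
  px : ℝ
  py : ℝ

/-- The Hamiltonian of the anisotropic Manev problem with anisotropy `μ` and parameter `b`:
`H = (px² + py²)/2 - 1/√(x² + μ y²) - b/(x² + μ y²)`. -/
noncomputable def manevH (μ b x y px py : ℝ) : ℝ :=
  (px ^ 2 + py ^ 2) / 2 - 1 / Real.sqrt (x ^ 2 + μ * y ^ 2) - b / (x ^ 2 + μ * y ^ 2)

/-- `γ : ℝ → PhasePoint` is a (classical, collision-free, globally defined) solution of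
`q̇ = p`, `ṗ = -∂H/∂q` for the anisotropic Manev Hamiltonian. -/
structure IsManevSolution (μ b : ℝ) (γ : ℝ → PhasePoint) : Prop where
  no_collision : ∀ t, ¬ ((γ t).x = 0 ∧ (γ t).y = 0)
  deriv_x : ∀ t, HasDerivAt (fun s => (γ s).x) (γ t).px t
  deriv_y : ∀ t, HasDerivAt (fun s => (γ s).y) (γ t).py t
  deriv_px : ∀ t, HasDerivAt (fun s => (γ s).px)
    (-(deriv (fun u => manevH μ b u (γ t).y (γ t).px (γ t).py) (γ t).x)) t
  deriv_py : ∀ t, HasDerivAt (fun s => (γ s).py)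
    (-(deriv (fun u => manevH μ b (γ t).x u (γ t).px (γ t).py) (γ t).y)) t

/-- The phase-space part of the time-preserving symmetry
`S₃ (x, y, px, py, t) = (-x, -y, -px, -py, t)`. -/
def symS3 (P : PhasePoint) : PhasePoint where
  x := -P.x
  y := -P.y
  px := -P.px
  py := -P.py

/-- `S₃`-symmetry of a `T`-periodic orbit `γ`: the map `S₃` carries the orbit to itself, as the
translation of time by half a period. (For a periodic solution with odd winding number, invariance
of the orbit in phase space under `S₃` can only happen in this way: `S₃` preserves the direction of
time and is an involution, so it shifts time by half the minimal period, and `T` is an odd multiple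
of the minimal period.) -/
def IsS3Symmetric (T : ℝ) (γ : ℝ → PhasePoint) : Prop :=
  ∀ t, γ (t + T / 2) = symS3 (γ t)

/-- The position curve `t ↦ (x(t), y(t))`, `t ∈ [0, T]`, avoids the origin and winds around it
`n` times, counted positively counterclockwise: along a continuous choice `θ` of the polar angle,
the total increase of `θ` is `2πn`. -/
def HasWindingNumber (T : ℝ) (γ : ℝ → PhasePoint) (n : ℤ) : Prop :=
  ∃ r θ : ℝ → ℝ, ContinuousOn θ (Set.Icc 0 T) ∧
    (∀ t ∈ Set.Icc 0 T, 0 < r t ∧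
      (γ t).x = r t * Real.cos (θ t) ∧ (γ t).y = r t * Real.sin (θ t)) ∧
    θ T - θ 0 = 2 * Real.pi * n

/-!
The solution is found by minimizing the action `∫ |q̇|²/2 + U(q)`, `U = 1/√(x² + μy²) + b/(x² + μy²)`,
over half a period `τ = T/2` among the loops with `q (t + τ) = -q t` and winding number `n`. This
works for every odd `n`.

Positions are complex numbers, and a loop is written as `q = exp ∘ w` with `w (t + τ) = w t + nπi`
(`IsLogPath`). This one condition encodes the absence of collisions, the `S₃`-symmetry (for odd `n`)
and the winding number.

* Coercivity. The term `b/(x² + μy²)` is a strong force: since `|q̇| = e^ρ |ẇ|` with `ρ = Re w` and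
  `U ≥ b e^{-2ρ}/μ`, the Lagrangian is at least a constant times `|ẇ|`. A bound on the action
  therefore bounds the oscillation of `w`. With it, `ρ` is bounded above because winding
  around the origin costs kinetic energy, and bounded below because of the potential
  (`IsLogPath.exists_bounds`). The bound on the kinetic energy makes `w` equicontinuous, and the
  Arzelà-Ascoli theorem gives a minimizing sequence with a continuous pointwise limit
  (`exists_minimizing_seq`).
* Euler-Lagrange equation. In the change of action under a variation `q + εφ`, the mixed term
  `ε ∫ ⟨q̇, φ̇⟩` equals `-ε ∫ ⟨q, φ̈⟩`, so the change is continuous under pointwise convergence of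
  loops in a fixed annulus (`manevAction_add_smul`). The limit thus satisfies
  `∫ ⟨∇U(q), φ⟩ = ∫ ⟨q, φ̈⟩` for all `C²` antiperiodic `φ` (`integral_grad_eq_of_minimizing`). Neither
  Sobolev spaces nor weak lower semicontinuity are needed.
* Regularity. Continuous antiperiodic functions have unique antiperiodic primitives, and the weak
  equation forces `q` to be the second antiperiodic primitive of `∇U(q)` (`eq_antiPrim_antiPrim`), so
  `q` is a classical solution on all of `ℝ`.
-/

/-! ### The potential and its gradient -/

/-- The anisotropic quadratic form `x² + μ y²` of the position `z = x + i y`. -/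
def anisoSq (μ : ℝ) (z : ℂ) : ℝ := z.re ^ 2 + μ * z.im ^ 2

/-- The force function `U = 1/√(x² + μ y²) + b/(x² + μ y²)`, the negative of the potential energy,
so that the Lagrangian is `|q̇|²/2 + U(q)`. -/
noncomputable def manevU (μ b : ℝ) (z : ℂ) : ℝ :=
  1 / √(anisoSq μ z) + b / anisoSq μ z

/-- The gradient of `manevU`, as a complex number. -/
noncomputable def manevGrad (μ b : ℝ) (z : ℂ) : ℂ :=
  ⟨-(1 / (√(anisoSq μ z) * anisoSq μ z) + 2 * b / anisoSq μ z ^ 2) * z.re,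
    -(1 / (√(anisoSq μ z) * anisoSq μ z) + 2 * b / anisoSq μ z ^ 2) * (μ * z.im)⟩

section Potential

variable {μ b : ℝ}

lemma norm_sq_le_anisoSq (hμ : 1 < μ) (z : ℂ) : ‖z‖ ^ 2 ≤ anisoSq μ z := by
  rw [Complex.sq_norm, Complex.normSq_apply, anisoSq]
  nlinarith [sq_nonneg z.im]

lemma anisoSq_le_mul_norm_sq (hμ : 1 < μ) (z : ℂ) : anisoSq μ z ≤ μ * ‖z‖ ^ 2 := by
  rw [Complex.sq_norm, Complex.normSq_apply, anisoSq]
  nlinarith [sq_nonneg z.re]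

lemma anisoSq_pos (hμ : 1 < μ) {z : ℂ} (hz : z ≠ 0) : 0 < anisoSq μ z :=
  lt_of_lt_of_le (by positivity) (norm_sq_le_anisoSq hμ z)

lemma anisoSq_nonneg (hμ : 1 < μ) (z : ℂ) : 0 ≤ anisoSq μ z :=
  le_trans (by positivity) (norm_sq_le_anisoSq hμ z)

lemma manevU_nonneg (hμ : 1 < μ) (hb : 0 < b) (z : ℂ) : 0 ≤ manevU μ b z := by
  have := anisoSq_nonneg hμ z
  unfold manevU
  positivity

/-- The strong force bound: `U` dominates a multiple of `1/|z|²`. -/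
lemma div_norm_sq_le_manevU (hμ : 1 < μ) (hb : 0 < b) {z : ℂ} (hz : z ≠ 0) :
    b / (μ * ‖z‖ ^ 2) ≤ manevU μ b z := by
  have h1 := anisoSq_pos hμ hz
  have h2 : b / (μ * ‖z‖ ^ 2) ≤ b / anisoSq μ z := by
    gcongr
    exact anisoSq_le_mul_norm_sq hμ z
  have h3 : 0 ≤ 1 / √(anisoSq μ z) := by positivity
  unfold manevU
  linarith

lemma manevU_le (hμ : 1 < μ) (hb : 0 < b) {r : ℝ} (hr : 0 < r) {z : ℂ} (hz : r ≤ ‖z‖) :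
    manevU μ b z ≤ 1 / r + b / r ^ 2 := by
  have h1 : r ^ 2 ≤ anisoSq μ z := le_trans (by gcongr) (norm_sq_le_anisoSq hμ z)
  have h2 : r ≤ √(anisoSq μ z) := Real.le_sqrt_of_sq_le h1
  unfold manevU
  gcongr

lemma continuous_anisoSq : Continuous (anisoSq μ) := by
  unfold anisoSq
  fun_prop

lemma continuousAt_manevU (hμ : 1 < μ) {z : ℂ} (hz : z ≠ 0) : ContinuousAt (manevU μ b) z := by
  have h := anisoSq_pos hμ hz
  have hc := (continuous_anisoSq (μ := μ)).continuousAt (x := z)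
  unfold manevU
  exact (continuousAt_const.div hc.sqrt (by positivity)).add (continuousAt_const.div hc h.ne')

lemma continuousAt_manevGrad (hμ : 1 < μ) {z : ℂ} (hz : z ≠ 0) :
    ContinuousAt (manevGrad μ b) z := by
  have h := anisoSq_pos hμ hz
  have hc := (continuous_anisoSq (μ := μ)).continuousAt (x := z)
  have hk : ContinuousAt (fun z => -(1 / (√(anisoSq μ z) * anisoSq μ z) +
      2 * b / anisoSq μ z ^ 2)) z :=
    ((continuousAt_const.div (hc.sqrt.mul hc) (mul_pos (Real.sqrt_pos.2 h) h).ne').add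
      (continuousAt_const.div (hc.pow 2) (pow_pos h 2).ne')).neg
  have he : manevGrad μ b = fun z => Complex.equivRealProdCLM.symm
      (-(1 / (√(anisoSq μ z) * anisoSq μ z) + 2 * b / anisoSq μ z ^ 2) * z.re,
        -(1 / (√(anisoSq μ z) * anisoSq μ z) + 2 * b / anisoSq μ z ^ 2) * (μ * z.im)) := by
    funext z
    apply Complex.ext <;> simp [manevGrad]
  rw [he]
  exact Complex.equivRealProdCLM.symm.continuous.continuousAt.comp
    ((hk.mul Complex.continuous_re.continuousAt).prodMk
      (hk.mul (continuousAt_const.mul Complex.continuous_im.continuousAt)))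

lemma manevGrad_neg (z : ℂ) : manevGrad μ b (-z) = -manevGrad μ b z := by
  apply Complex.ext <;> simp [manevGrad, anisoSq]

lemma hasDerivAt_manevU_comp (hμ : 1 < μ) {z : ℝ → ℂ} {z' : ℂ} {t : ℝ}
    (hz : HasDerivAt z z' t) (h0 : z t ≠ 0) :
    HasDerivAt (fun s => manevU μ b (z s)) (inner ℝ (manevGrad μ b (z t)) z') t := by
  have hN := anisoSq_pos hμ h0
  have hre : HasDerivAt (fun s => (z s).re) z'.re t :=
    Complex.reCLM.hasFDerivAt.comp_hasDerivAt t hz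
  have him : HasDerivAt (fun s => (z s).im) z'.im t :=
    Complex.imCLM.hasFDerivAt.comp_hasDerivAt t hz
  have h1 : HasDerivAt (fun s => anisoSq μ (z s))
      (2 * (z t).re * z'.re + μ * (2 * (z t).im * z'.im)) t := by
    refine ((hre.pow 2).add ((him.pow 2).const_mul μ)).congr_deriv ?_
    norm_num
  have hs : 0 < √(anisoSq μ (z t)) := by positivity
  have h2 := ((h1.sqrt hN.ne').inv hs.ne').add ((h1.inv hN.ne').const_mul b)
  have h3 : (fun s => manevU μ b (z s)) = (fun s => √(anisoSq μ (z s)))⁻¹ +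
      fun s => b * (fun s => anisoSq μ (z s))⁻¹ s := by
    funext s
    simp [manevU, div_eq_mul_inv]
  rw [h3]
  refine h2.congr_deriv ?_
  simp only [Complex.inner, manevGrad, Complex.mul_re, Complex.conj_re, Complex.conj_im]
  rw [Real.sq_sqrt hN.le]
  field_simp
  ring

end Potential

/-! ### Antiperiodic primitives and weak solutions -/

/-- The primitive of `f` whose value at `0` is minus half the integral over `[0, τ]`. If `f` is
`τ`-antiperiodic, it is the only `τ`-antiperiodic primitive of `f`. -/
noncomputable def antiPrim (τ : ℝ) (f : ℝ → ℂ) (t : ℝ) : ℂ :=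
  (∫ s in (0 : ℝ)..t, f s) - (1 / 2 : ℝ) • ∫ s in (0 : ℝ)..τ, f s

section Antiperiodic

variable {τ : ℝ}

lemma hasDerivAt_antiPrim {f : ℝ → ℂ} (hf : Continuous f) (t : ℝ) :
    HasDerivAt (antiPrim τ f) (f t) t :=
  (intervalIntegral.integral_hasDerivAt_right (hf.intervalIntegrable _ _)
    (hf.stronglyMeasurableAtFilter _ _) hf.continuousAt).sub_const _

lemma continuous_antiPrim {f : ℝ → ℂ} (hf : Continuous f) : Continuous (antiPrim τ f) :=
  continuous_iff_continuousAt.2 fun t => (hasDerivAt_antiPrim hf t).continuousAt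

lemma antiperiodic_antiPrim {f : ℝ → ℂ} (hf : Continuous f) (ha : Function.Antiperiodic f τ) :
    Function.Antiperiodic (antiPrim τ f) τ := by
  intro t
  have h1 : ∫ s in (0 : ℝ)..t + τ, f s
      = (∫ s in (0 : ℝ)..τ, f s) + ∫ s in τ..t + τ, f s :=
    (intervalIntegral.integral_add_adjacent_intervals (hf.intervalIntegrable _ _)
      (hf.intervalIntegrable _ _)).symm
  have h2 : ∫ s in τ..t + τ, f s = -∫ s in (0 : ℝ)..t, f s := by
    have := intervalIntegral.integral_comp_add_right (a := 0) (b := t) f τ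
    rw [zero_add] at this
    rw [← this, ← intervalIntegral.integral_neg]
    exact intervalIntegral.integral_congr fun s _ => ha s
  simp only [antiPrim, h1, h2, Complex.real_smul]
  push_cast
  ring

/-- Integration by parts over one antiperiod: the boundary terms cancel. -/
lemma integral_inner_deriv_add_eq_zero {f g f' g' : ℝ → ℂ}
    (hf : ∀ t, HasDerivAt f (f' t) t) (hg : ∀ t, HasDerivAt g (g' t) t)
    (hf' : Continuous f') (hg' : Continuous g')
    (haf : Function.Antiperiodic f τ) (hag : Function.Antiperiodic g τ) :
    (∫ t in (0 : ℝ)..τ, inner ℝ (f t) (g' t)) + ∫ t in (0 : ℝ)..τ, inner ℝ (f' t) (g t) = 0 := by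
  have hfc : Continuous f := continuous_iff_continuousAt.2 fun t => (hf t).continuousAt
  have hgc : Continuous g := continuous_iff_continuousAt.2 fun t => (hg t).continuousAt
  have hi : Continuous fun t => (inner ℝ (f t) (g' t) : ℝ) := hfc.inner hg'
  have hj : Continuous fun t => (inner ℝ (f' t) (g t) : ℝ) := hf'.inner hgc
  rw [← intervalIntegral.integral_add (hi.intervalIntegrable _ _) (hj.intervalIntegrable _ _),
    intervalIntegral.integral_eq_sub_of_hasDerivAt
      (fun t _ => (hf t).inner ℝ (hg t)) ((hi.add hj).intervalIntegrable _ _)]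
  have h1 := haf 0
  have h2 := hag 0
  rw [zero_add] at h1 h2
  rw [h1, h2, inner_neg_neg, sub_self]

/-- Regularity of weak solutions of `q̈ = g` among continuous antiperiodic functions: testing against
the second antiperiodic primitive of `P P g - q`, where `P` is `antiPrim τ`, gives
`∫ |P P g - q|² = 0`. -/
lemma eq_antiPrim_antiPrim (hτ : 0 < τ) {q g : ℝ → ℂ} (hq : Continuous q) (hg : Continuous g)
    (haq : Function.Antiperiodic q τ) (hag : Function.Antiperiodic g τ)
    (hweak : ∀ φ φ' φ'' : ℝ → ℂ, (∀ t, HasDerivAt φ (φ' t) t) → (∀ t, HasDerivAt φ' (φ'' t) t) →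
      Continuous φ'' → Function.Antiperiodic φ τ → Function.Antiperiodic φ' τ →
      (∫ t in (0 : ℝ)..τ, inner ℝ (g t) (φ t)) = ∫ t in (0 : ℝ)..τ, inner ℝ (q t) (φ'' t)) :
    q = antiPrim τ (antiPrim τ g) := by
  set G₁ := antiPrim τ g with hG₁
  set G := antiPrim τ G₁ with hG
  have hG₁c : Continuous G₁ := continuous_antiPrim hg
  have hG₁a : Function.Antiperiodic G₁ τ := antiperiodic_antiPrim hg hag
  have hGc : Continuous G := continuous_antiPrim hG₁c
  have hGa : Function.Antiperiodic G τ := antiperiodic_antiPrim hG₁c hG₁a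
  have huc : Continuous (G - q) := hGc.sub hq
  have hua : Function.Antiperiodic (G - q) τ := fun t => by
    simp only [Pi.sub_apply, hGa t, haq t]
    ring
  set φ₁ := antiPrim τ (G - q) with hφ₁
  have hφ₁c : Continuous φ₁ := continuous_antiPrim huc
  have hφ₁a : Function.Antiperiodic φ₁ τ := antiperiodic_antiPrim huc hua
  set φ := antiPrim τ φ₁ with hφ
  have hφc : Continuous φ := continuous_antiPrim hφ₁c
  have hφa : Function.Antiperiodic φ τ := antiperiodic_antiPrim hφ₁c hφ₁a
  have hw := hweak φ φ₁ (G - q) (hasDerivAt_antiPrim hφ₁c) (hasDerivAt_antiPrim huc) huc hφa hφ₁a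
  have hp1 := integral_inner_deriv_add_eq_zero (τ := τ) (hasDerivAt_antiPrim hg)
    (hasDerivAt_antiPrim hφ₁c) hg hφ₁c hG₁a hφa
  have hp2 := integral_inner_deriv_add_eq_zero (τ := τ) (hasDerivAt_antiPrim hG₁c)
    (hasDerivAt_antiPrim huc) hG₁c huc hGa hφ₁a
  rw [← hG₁, ← hφ] at hp1
  rw [← hG, ← hφ₁] at hp2
  have hI : ∫ t in (0 : ℝ)..τ, ‖(G - q) t‖ ^ 2 = 0 := by
    have h1 : ∀ t, ‖(G - q) t‖ ^ 2 = inner ℝ (G t) ((G - q) t) - inner ℝ (q t) ((G - q) t) := by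
      intro t
      rw [← inner_sub_left, ← real_inner_self_eq_norm_sq, Pi.sub_apply]
    simp_rw [h1]
    rw [intervalIntegral.integral_sub ((hGc.inner huc).intervalIntegrable _ _)
      ((hq.inner huc).intervalIntegrable _ _)]
    linarith
  have hz : ∀ t ∈ Set.Icc 0 τ, (G - q) t = 0 := by
    by_contra! h
    obtain ⟨t, ht, hne⟩ := h
    have := intervalIntegral.integral_pos hτ (f := fun t => ‖(G - q) t‖ ^ 2)
      (by fun_prop) (fun _ _ => by positivity) ⟨t, ht, by positivity⟩
    linarith
  have hper : Function.Periodic (fun t => ‖(G - q) t‖) τ := fun t => by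
    simp only [hua t, norm_neg]
  funext t
  obtain ⟨s, hs, hst⟩ := hper.exists_mem_Ico₀ hτ t
  have h0 : ‖(G - q) t‖ = 0 := by
    rw [hst, hz s ⟨hs.1, hs.2.le⟩, norm_zero]
  have := norm_eq_zero.1 h0
  rw [Pi.sub_apply, sub_eq_zero] at this
  exact this.symm

lemma exists_norm_le_of_antiperiodic (hτ : 0 < τ) {f : ℝ → ℂ} (hf : Continuous f)
    (ha : Function.Antiperiodic f τ) : ∃ B, ∀ t, ‖f t‖ ≤ B := by
  obtain ⟨B, hB⟩ := isCompact_Icc.exists_bound_of_continuousOn (s := Set.Icc 0 τ) hf.continuousOn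
  refine ⟨B, fun t => ?_⟩
  have hper : Function.Periodic (fun t => ‖f t‖) τ := fun t => by simp only [ha t, norm_neg]
  obtain ⟨s, hs, hst⟩ := hper.exists_mem_Ico₀ hτ t
  rw [hst]
  exact hB s ⟨hs.1, hs.2.le⟩

end Antiperiodic

/-! ### Paths in the logarithmic coordinate and their action -/

/-- A `C¹` path `w` on `ℝ` with `w (t + τ) = w t + nπi`. For odd `n` it is a logarithm of the
`τ`-antiperiodic loop `q = exp ∘ w`, which avoids the origin and winds `n` times around it in time
`2τ`: `Re w` is the logarithm of the radius and `Im w` is a continuous polar angle. -/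
structure IsLogPath (τ : ℝ) (n : ℤ) (w : ℝ → ℂ) : Prop where
  contDiff : ContDiff ℝ 1 w
  add_half : ∀ t, w (t + τ) = w t + n * (Real.pi * Complex.I)

/-- The Lagrangian action of the path `q` over the time interval `[0, τ]`. -/
noncomputable def manevAction (μ b τ : ℝ) (q : ℝ → ℂ) : ℝ :=
  ∫ t in (0 : ℝ)..τ, (‖deriv q t‖ ^ 2 / 2 + manevU μ b (q t))

lemma antiperiodic_exp {τ : ℝ} {n : ℤ} (hn : Odd n) {w : ℝ → ℂ}
    (hw : ∀ t, w (t + τ) = w t + n * (Real.pi * Complex.I)) :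
    Function.Antiperiodic (fun t => Complex.exp (w t)) τ := by
  intro t
  simp only [hw t, Complex.exp_add, Complex.exp_int_mul, Complex.exp_pi_mul_I, hn.neg_one_zpow]
  ring

namespace IsLogPath

variable {μ b τ : ℝ} {n : ℤ} {w : ℝ → ℂ}

lemma hasDerivAt (hw : IsLogPath τ n w) (t : ℝ) : HasDerivAt w (deriv w t) t :=
  (hw.contDiff.differentiable one_ne_zero t).hasDerivAt

lemma continuous_deriv (hw : IsLogPath τ n w) : Continuous (deriv w) :=
  hw.contDiff.continuous_deriv le_rfl

lemma contDiff_exp (hw : IsLogPath τ n w) : ContDiff ℝ 1 fun t => Complex.exp (w t) :=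
  hw.contDiff.cexp

lemma hasDerivAt_exp (hw : IsLogPath τ n w) (t : ℝ) :
    HasDerivAt (fun t => Complex.exp (w t)) (Complex.exp (w t) * deriv w t) t :=
  (hw.hasDerivAt t).cexp

lemma norm_deriv_exp (hw : IsLogPath τ n w) (t : ℝ) :
    ‖deriv (fun t => Complex.exp (w t)) t‖ = Real.exp (w t).re * ‖deriv w t‖ := by
  rw [(hw.hasDerivAt_exp t).deriv, norm_mul, Complex.norm_exp]

lemma continuous_deriv_exp (hw : IsLogPath τ n w) :
    Continuous (deriv fun t => Complex.exp (w t)) :=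
  hw.contDiff_exp.continuous_deriv le_rfl

lemma periodic_norm_deriv (hw : IsLogPath τ n w) :
    Function.Periodic (fun t => ‖deriv w t‖) τ := by
  intro t
  have h : (fun s => w (s + τ)) = fun s => w s + n * (Real.pi * Complex.I) :=
    funext hw.add_half
  have h1 : deriv (fun s => w (s + τ)) t = deriv w (t + τ) := deriv_comp_add_const w τ t
  rw [h, deriv_add_const] at h1
  simp only [← h1]

lemma add_const (hw : IsLogPath τ n w) (c : ℂ) : IsLogPath τ n fun t => w t + c where
  contDiff := hw.contDiff.add contDiff_const
  add_half t := by
    rw [hw.add_half]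
    ring

lemma continuous_lagrangian (hμ : 1 < μ) (hw : IsLogPath τ n w) :
    Continuous fun t => ‖deriv (fun t => Complex.exp (w t)) t‖ ^ 2 / 2 +
      manevU μ b (Complex.exp (w t)) := by
  have h1 : Continuous fun t => manevU μ b (Complex.exp (w t)) :=
    continuous_iff_continuousAt.2 fun t =>
      ContinuousAt.comp (f := fun t => Complex.exp (w t))
        (continuousAt_manevU hμ (Complex.exp_ne_zero _))
        hw.contDiff_exp.continuous.continuousAt
  have h2 := hw.continuous_deriv_exp
  fun_prop

/-- A lower bound for the Lagrangian of the loop `exp ∘ w` in terms of `Re w` and `ẇ`. -/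
lemma le_lagrangian (hμ : 1 < μ) (hb : 0 < b) (hw : IsLogPath τ n w) (t : ℝ) :
    Real.exp (w t).re ^ 2 * ‖deriv w t‖ ^ 2 / 2 + b / (μ * Real.exp (w t).re ^ 2) ≤
      ‖deriv (fun t => Complex.exp (w t)) t‖ ^ 2 / 2 + manevU μ b (Complex.exp (w t)) := by
  have h := div_norm_sq_le_manevU hμ hb (Complex.exp_ne_zero (w t))
  rw [Complex.norm_exp] at h
  rw [hw.norm_deriv_exp, mul_pow]
  linarith

/-- The strong force condition: the action dominates the length of `w`, since
`s² v² / 2 + c² / (2 s²) ≥ c v`. -/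
lemma integral_norm_deriv_le (hμ : 1 < μ) (hb : 0 < b) (hτ : 0 < τ) (hw : IsLogPath τ n w) :
    √(2 * b / μ) * ∫ t in (0 : ℝ)..τ, ‖deriv w t‖ ≤
      manevAction μ b τ fun t => Complex.exp (w t) := by
  rw [← intervalIntegral.integral_const_mul]
  have hc := hw.continuous_deriv
  refine intervalIntegral.integral_mono_on hτ.le ?_
    ((hw.continuous_lagrangian hμ).intervalIntegrable _ _) fun t _ =>
      le_trans ?_ (hw.le_lagrangian hμ hb t)
  · exact (continuous_const.mul hc.norm).intervalIntegrable _ _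
  · have hs := Real.exp_pos (w t).re
    set s := Real.exp (w t).re
    set c := √(2 * b / μ) with hcdef
    have hc2 : c ^ 2 = 2 * b / μ := Real.sq_sqrt (by positivity)
    have h1 : b / (μ * s ^ 2) = (c / s) ^ 2 / 2 := by
      rw [div_pow, hc2]
      field_simp
    rw [h1]
    have h2 : c * ‖deriv w t‖ = (s * ‖deriv w t‖) * (c / s) := by
      field_simp
    rw [h2]
    nlinarith [sq_nonneg (s * ‖deriv w t‖ - c / s)]

lemma norm_sub_le_integral (hw : IsLogPath τ n w) {s t : ℝ} (hst : s ≤ t) :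
    ‖w t - w s‖ ≤ ∫ r in s..t, ‖deriv w r‖ := by
  rw [← intervalIntegral.integral_eq_sub_of_hasDerivAt (fun r _ => hw.hasDerivAt r)
    (hw.continuous_deriv.intervalIntegrable _ _)]
  exact intervalIntegral.norm_integral_le_integral_norm hst

lemma norm_sub_le_integral_half (hw : IsLogPath τ n w) {s t : ℝ} (hs : s ∈ Set.Icc 0 τ)
    (ht : t ∈ Set.Icc 0 τ) : ‖w t - w s‖ ≤ ∫ r in (0 : ℝ)..τ, ‖deriv w r‖ := by
  wlog hst : s ≤ t generalizing s t
  · rw [norm_sub_rev]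
    exact this ht hs (le_of_not_ge hst)
  refine (hw.norm_sub_le_integral hst).trans ?_
  exact intervalIntegral.integral_mono_interval hs.1 hst ht.2
    (Filter.Eventually.of_forall fun _ => norm_nonneg _)
    (hw.continuous_deriv.norm.intervalIntegrable _ _)

/-- The length of `w` over `[0, τ]` is at least `π`, because `n ≠ 0`. -/
lemma pi_le_integral_norm_deriv (hn : Odd n) (hτ : 0 < τ) (hw : IsLogPath τ n w) :
    Real.pi ≤ ∫ r in (0 : ℝ)..τ, ‖deriv w r‖ := by
  refine le_trans ?_ (hw.norm_sub_le_integral hτ.le)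
  have h := hw.add_half 0
  rw [zero_add] at h
  rw [h, add_sub_cancel_left, norm_mul, norm_mul, Complex.norm_I, Complex.norm_real,
    Real.norm_of_nonneg Real.pi_pos.le, Complex.norm_intCast, mul_one]
  have h0 : n ≠ 0 := fun h => by simp [h] at hn
  have h1 : (1 : ℝ) ≤ |(n : ℝ)| := by exact_mod_cast Int.one_le_abs h0
  nlinarith [Real.pi_pos]

/-- Loops of bounded action stay in a fixed annulus, and their logarithms have bounded oscillation.
A large loop is excluded by the kinetic energy needed to wind around the origin, a small one by the
potential. -/
lemma exists_bounds (hμ : 1 < μ) (hb : 0 < b) (hτ : 0 < τ) (hn : Odd n) (M : ℝ) :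
    ∃ R L : ℝ, ∀ w, IsLogPath τ n w → manevAction μ b τ (fun t => Complex.exp (w t)) ≤ M →
      (∀ t, |(w t).re| ≤ R) ∧
      ∀ s ∈ Set.Icc 0 τ, ∀ t ∈ Set.Icc 0 τ, ‖w t - w s‖ ≤ L := by
  have hc : 0 < √(2 * b / μ) := by positivity
  set L := M / √(2 * b / μ) with hL
  refine ⟨max (L + M * τ / Real.pi ^ 2) (L + M * μ / (2 * b * τ)), L, fun w hw hM => ?_⟩
  have hosc : ∀ s ∈ Set.Icc 0 τ, ∀ t ∈ Set.Icc 0 τ, ‖w t - w s‖ ≤ L := by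
    intro s hs t ht
    refine (hw.norm_sub_le_integral_half hs ht).trans ?_
    rw [hL, le_div_iff₀ hc, mul_comm]
    exact (hw.integral_norm_deriv_le hμ hb hτ).trans hM
  refine ⟨?_, hosc⟩
  have hre : ∀ s ∈ Set.Icc 0 τ, ∀ t ∈ Set.Icc 0 τ, (w t).re ≤ (w s).re + L := by
    intro s hs t ht
    have := (Complex.abs_re_le_norm (w t - w s)).trans (hosc s hs t ht)
    rw [Complex.sub_re] at this
    linarith [le_abs_self ((w t).re - (w s).re)]
  have hv := hw.continuous_deriv.norm
  have key : ∀ s ∈ Set.Icc 0 τ, |(w s).re| ≤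
      max (L + M * τ / Real.pi ^ 2) (L + M * μ / (2 * b * τ)) := by
    intro s hs
    rw [abs_le']
    constructor
    · refine le_max_of_le_left ?_
      set E := Real.exp ((w s).re - L) with hE
      have hEpos : 0 < E := Real.exp_pos _
      -- `v² ≥ 2av - a²` with `a = π/τ` plays the role of the Cauchy-Schwarz inequality
      have h1 : ∫ t in (0 : ℝ)..τ, (E ^ 2 * (Real.pi / τ) * ‖deriv w t‖
          - E ^ 2 * (Real.pi / τ) ^ 2 / 2) ≤ M := by
        refine le_trans ?_ hM
        refine intervalIntegral.integral_mono_on hτ.le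
          (((continuous_const.mul hv).sub continuous_const).intervalIntegrable _ _)
          ((hw.continuous_lagrangian hμ).intervalIntegrable _ _) fun t ht =>
          le_trans ?_ (hw.le_lagrangian hμ hb t)
        have h2 : E ≤ Real.exp (w t).re := Real.exp_le_exp.2 (by linarith [hre t ht s hs])
        have h3 : E ^ 2 ≤ Real.exp (w t).re ^ 2 := by gcongr
        have h4 : 0 ≤ b / (μ * Real.exp (w t).re ^ 2) := by positivity
        nlinarith [mul_nonneg (sq_nonneg E) (sq_nonneg (‖deriv w t‖ - Real.pi / τ)),
          mul_le_mul_of_nonneg_right h3 (sq_nonneg ‖deriv w t‖)]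
      have hv' : Continuous fun t => E ^ 2 * (Real.pi / τ) * ‖deriv w t‖ :=
        continuous_const.mul hv
      rw [intervalIntegral.integral_sub (hv'.intervalIntegrable _ _)
        (continuous_const.intervalIntegrable _ _), intervalIntegral.integral_const_mul,
        intervalIntegral.integral_const, smul_eq_mul, sub_zero] at h1
      have h2 := mul_le_mul_of_nonneg_left (hw.pi_le_integral_norm_deriv hn hτ)
        (show 0 ≤ E ^ 2 * (Real.pi / τ) by positivity)
      have h3 : E ^ 2 * (Real.pi / τ) * Real.pi - τ * (E ^ 2 * (Real.pi / τ) ^ 2 / 2)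
          = E ^ 2 * (Real.pi ^ 2 / (2 * τ)) := by
        field_simp
        ring
      have h4 : E ^ 2 ≤ 2 * M * τ / Real.pi ^ 2 := by
        rw [le_div_iff₀ (by positivity)]
        have : E ^ 2 * (Real.pi ^ 2 / (2 * τ)) ≤ M := by linarith
        have h5 := mul_le_mul_of_nonneg_right this (show 0 ≤ 2 * τ by positivity)
        have h6 : E ^ 2 * (Real.pi ^ 2 / (2 * τ)) * (2 * τ) = E ^ 2 * Real.pi ^ 2 := by
          field_simp
        linarith
      have h5 : E ^ 2 = Real.exp (2 * ((w s).re - L)) := by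
        rw [hE, ← Real.exp_nat_mul]
        norm_num
      have h6 := Real.add_one_le_exp (2 * ((w s).re - L))
      have h7 : 2 * M * τ / Real.pi ^ 2 = 2 * (M * τ / Real.pi ^ 2) := by ring
      linarith
    · refine le_max_of_le_right ?_
      set E := Real.exp (-2 * ((w s).re + L)) with hE
      have h1 : ∫ t in (0 : ℝ)..τ, b / μ * E ≤ M := by
        refine le_trans ?_ hM
        refine intervalIntegral.integral_mono_on hτ.le
          (continuous_const.intervalIntegrable _ _)
          ((hw.continuous_lagrangian hμ).intervalIntegrable _ _) fun t ht =>
          le_trans ?_ (hw.le_lagrangian hμ hb t)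
        have h2 : E ≤ Real.exp (-2 * (w t).re) :=
          Real.exp_le_exp.2 (by linarith [hre s hs t ht])
        have h3 : b / (μ * Real.exp (w t).re ^ 2) = b / μ * Real.exp (-2 * (w t).re) := by
          rw [neg_mul, Real.exp_neg, show Real.exp (2 * (w t).re) = Real.exp (w t).re ^ 2 by
            rw [← Real.exp_nat_mul]; norm_num]
          field_simp
        have h4 : b / μ * E ≤ b / μ * Real.exp (-2 * (w t).re) := by gcongr
        have h5 : 0 ≤ Real.exp (w t).re ^ 2 * ‖deriv w t‖ ^ 2 / 2 := by positivity
        linarith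
      rw [intervalIntegral.integral_const, smul_eq_mul, sub_zero] at h1
      have h2 : E ≤ 2 * (M * μ / (2 * b * τ)) := by
        have h3 : 2 * (M * μ / (2 * b * τ)) = M * μ / (b * τ) := by
          field_simp
        rw [h3, le_div_iff₀ (by positivity)]
        have h4 := mul_le_mul_of_nonneg_right h1 (show 0 ≤ μ by positivity)
        have h5 : τ * (b / μ * E) * μ = E * (b * τ) := by
          field_simp
        linarith
      have h6 := Real.add_one_le_exp (-2 * ((w s).re + L))
      linarith
  have hper : Function.Periodic (fun t => (w t).re) τ := fun t => by
    simp [hw.add_half t]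
  intro t
  obtain ⟨s, hs, hst⟩ := hper.exists_mem_Ico₀ hτ t
  rw [show (w t).re = (w s).re from hst]
  exact key s ⟨hs.1, hs.2.le⟩

/-- Equicontinuity of the logarithms of loops of bounded action. The free parameter `a` replaces
the Hölder bound `‖w t - w s‖² ≤ K |t - s|`. -/
lemma two_mul_norm_sub_le (hμ : 1 < μ) (hb : 0 < b) (hτ : 0 < τ) (hw : IsLogPath τ n w)
    {M R : ℝ} (hM : manevAction μ b τ (fun t => Complex.exp (w t)) ≤ M)
    (hR : ∀ t, |(w t).re| ≤ R) {a : ℝ} (ha : 0 < a) {s t : ℝ} (hst : |t - s| ≤ τ) :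
    2 * ‖w t - w s‖ ≤ a * (2 * M * Real.exp (2 * R)) + |t - s| / a := by
  wlog h : s ≤ t generalizing s t
  · rw [norm_sub_rev, abs_sub_comm]
    exact this (by rwa [abs_sub_comm]) (le_of_not_ge h)
  rw [abs_of_nonneg (sub_nonneg.2 h)] at hst ⊢
  have hv := hw.continuous_deriv.norm
  have hv2 : Continuous fun r => a * ‖deriv w r‖ ^ 2 := continuous_const.mul (hv.pow 2)
  have hK : ∫ r in (0 : ℝ)..τ, ‖deriv w r‖ ^ 2 ≤ 2 * M * Real.exp (2 * R) := by
    have h1 : ∫ r in (0 : ℝ)..τ, ‖deriv w r‖ ^ 2 * (Real.exp (-2 * R) / 2) ≤ M := by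
      refine le_trans ?_ hM
      refine intervalIntegral.integral_mono_on hτ.le
        (((hv.pow 2).mul continuous_const).intervalIntegrable _ _)
        ((hw.continuous_lagrangian hμ).intervalIntegrable _ _) fun r _ =>
        le_trans ?_ (hw.le_lagrangian hμ hb r)
      have h2 : Real.exp (-2 * R) ≤ Real.exp (w r).re ^ 2 := by
        rw [← Real.exp_nat_mul]
        refine Real.exp_le_exp.2 ?_
        have := (abs_le.1 (hR r)).1
        push_cast
        linarith
      have h3 : 0 ≤ b / (μ * Real.exp (w r).re ^ 2) := by positivity
      nlinarith [mul_le_mul_of_nonneg_right h2 (sq_nonneg ‖deriv w r‖)]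
    rw [intervalIntegral.integral_mul_const] at h1
    have h2 := mul_le_mul_of_nonneg_right h1 (show 0 ≤ 2 * Real.exp (2 * R) by positivity)
    have h3 : Real.exp (-2 * R) * Real.exp (2 * R) = 1 := by
      rw [← Real.exp_add]
      simp
    calc ∫ r in (0 : ℝ)..τ, ‖deriv w r‖ ^ 2
        = (∫ r in (0 : ℝ)..τ, ‖deriv w r‖ ^ 2) * (Real.exp (-2 * R) * Real.exp (2 * R)) := by
          rw [h3, mul_one]
      _ ≤ 2 * M * Real.exp (2 * R) := by linarith
  have h1 : ∫ r in s..t, a * ‖deriv w r‖ ^ 2 ≤ a * (2 * M * Real.exp (2 * R)) := by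
    calc ∫ r in s..t, a * ‖deriv w r‖ ^ 2
        ≤ ∫ r in s..s + τ, a * ‖deriv w r‖ ^ 2 :=
          intervalIntegral.integral_mono_interval le_rfl h (by linarith)
            (Filter.Eventually.of_forall fun _ => by simp only [Pi.zero_apply]; positivity)
            (hv2.intervalIntegrable _ _)
      _ = ∫ r in (0 : ℝ)..0 + τ, a * ‖deriv w r‖ ^ 2 := by
          refine Function.Periodic.intervalIntegral_add_eq (fun r => ?_) _ _
          simp only [show ‖deriv w (r + τ)‖ = ‖deriv w r‖ from hw.periodic_norm_deriv r]
      _ ≤ _ := by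
          rw [zero_add, intervalIntegral.integral_const_mul]
          gcongr
  have h2 : ∫ r in s..t, 2 * ‖deriv w r‖ ≤ ∫ r in s..t, (a * ‖deriv w r‖ ^ 2 + 1 / a) := by
    refine intervalIntegral.integral_mono_on h ((continuous_const.mul hv).intervalIntegrable _ _)
      ((hv2.add continuous_const).intervalIntegrable _ _) fun r _ => ?_
    have : a * ‖deriv w r‖ ^ 2 + 1 / a - 2 * ‖deriv w r‖ = a * (‖deriv w r‖ - 1 / a) ^ 2 := by
      field_simp
      ring
    nlinarith [mul_nonneg ha.le (sq_nonneg (‖deriv w r‖ - 1 / a))]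
  rw [intervalIntegral.integral_const_mul,
    intervalIntegral.integral_add (hv2.intervalIntegrable _ _)
      (continuous_const.intervalIntegrable _ _), intervalIntegral.integral_const, smul_eq_mul,
    mul_one_div] at h2
  linarith [hw.norm_sub_le_integral h]

lemma norm_sub_le_sqrt (hμ : 1 < μ) (hb : 0 < b) (hτ : 0 < τ) (hw : IsLogPath τ n w)
    {M R : ℝ} (hM : manevAction μ b τ (fun t => Complex.exp (w t)) ≤ M)
    (hR : ∀ t, |(w t).re| ≤ R) {s t : ℝ} (hst : |t - s| ≤ τ) :
    ‖w t - w s‖ ≤ (M * Real.exp (2 * R) + 1) * √|t - s| := by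
  rcases eq_or_ne t s with rfl | hne
  · simp
  have h0 : 0 < |t - s| := abs_pos.2 (sub_ne_zero.2 hne)
  have h := hw.two_mul_norm_sub_le hμ hb hτ hM hR (Real.sqrt_pos.2 h0) hst
  rw [Real.div_sqrt] at h
  linarith [Real.sqrt_nonneg |t - s|]

/-- The admissible class is open under small antiperiodic variations of `q = exp ∘ w`. -/
lemma exists_exp_eq_add (hn : Odd n) (hw : IsLogPath τ n w) {φ : ℝ → ℂ} (hφ : ContDiff ℝ 1 φ)
    (haφ : Function.Antiperiodic φ τ) (hlt : ∀ t, ‖φ t‖ < ‖Complex.exp (w t)‖) :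
    ∃ w₁, IsLogPath τ n w₁ ∧ ∀ t, Complex.exp (w₁ t) = Complex.exp (w t) + φ t := by
  have hsp : ∀ t, 1 + φ t * Complex.exp (-w t) ∈ Complex.slitPlane := fun t => by
    refine Complex.mem_slitPlane_of_norm_lt_one ?_
    rw [Complex.exp_neg, ← div_eq_mul_inv, norm_div,
      div_lt_one (norm_pos_iff.2 (Complex.exp_ne_zero _))]
    exact hlt t
  have hcd : ContDiff ℝ 1 fun t => 1 + φ t * Complex.exp (-w t) :=
    contDiff_const.add (hφ.mul hw.contDiff.neg.cexp)
  have hlog : ContDiff ℝ 1 fun t => Complex.log (1 + φ t * Complex.exp (-w t)) :=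
    contDiff_iff_contDiffAt.2 fun t =>
      ContDiffAt.comp (g := Complex.log) t
        ((Complex.contDiffAt_log (hsp t)).restrict_scalars ℝ) hcd.contDiffAt
  refine ⟨fun t => w t + Complex.log (1 + φ t * Complex.exp (-w t)),
    ⟨hw.contDiff.add hlog, fun t => ?_⟩, fun t => ?_⟩
  · have h := antiperiodic_exp hn hw.add_half t
    simp only at h
    rw [Complex.exp_neg, h, haφ t, hw.add_half, inv_neg, neg_mul_neg, ← Complex.exp_neg]
    ring
  · rw [Complex.exp_add, Complex.exp_log (Complex.slitPlane_ne_zero (hsp t)), mul_add, mul_one,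
      mul_left_comm, ← Complex.exp_add, add_neg_cancel, Complex.exp_zero, mul_one]

end IsLogPath

/-! ### Compactness of minimizing sequences -/

open Filter Topology in
/-- Compactness: normalized logarithmic paths of bounded action converge pointwise along a
subsequence, and the limit is continuous. -/
lemma exists_tendsto_of_action_le {μ b τ : ℝ} {n : ℤ} (hμ : 1 < μ) (hb : 0 < b) (hτ : 0 < τ)
    (hn : Odd n) {M : ℝ} {u : ℕ → ℝ → ℂ} (hu : ∀ k, IsLogPath τ n (u k))
    (hM : ∀ k, manevAction μ b τ (fun t => Complex.exp (u k t)) ≤ M)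
    (him : ∀ k, |(u k 0).im| ≤ Real.pi) :
    ∃ (σ : ℕ → ℕ) (W : ℝ → ℂ), StrictMono σ ∧ Continuous W ∧
      ∀ t, Tendsto (fun k => u (σ k) t) atTop (𝓝 (W t)) := by
  obtain ⟨R, L, hRL⟩ := IsLogPath.exists_bounds hμ hb hτ hn M
  have hR := fun k => (hRL (u k) (hu k) (hM k)).1
  have hL := fun k => (hRL (u k) (hu k) (hM k)).2
  have h0 : (0 : ℝ) ∈ Set.Icc 0 τ := ⟨le_rfl, hτ.le⟩
  set C := M * Real.exp (2 * R) + 1 with hC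
  have hmod : ∀ k s t, |t - s| ≤ τ → ‖u k t - u k s‖ ≤ C * √|t - s| := fun k s t hst =>
    (hu k).norm_sub_le_sqrt hμ hb hτ (hM k) (hR k) hst
  let f : ℕ → BoundedContinuousFunction (Set.Icc 0 τ) ℂ := fun k =>
    BoundedContinuousFunction.mkOfCompact
      ⟨fun t => u k t, (hu k).contDiff.continuous.comp continuous_subtype_val⟩
  have hf : ∀ k t, f k t = u k t := fun k t => rfl
  have hlim : Tendsto (fun d => C * √|d|) (𝓝 0) (𝓝 0) := by
    have : Continuous fun d : ℝ => C * √|d| := by fun_prop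
    simpa using this.tendsto 0
  have hcomp : IsCompact (closure (Set.range f)) := by
    refine BoundedContinuousFunction.arzela_ascoli (Metric.closedBall 0 (R + Real.pi + L))
      (isCompact_closedBall _ _) _ ?_ ?_
    · rintro _ t ⟨k, rfl⟩
      rw [hf, mem_closedBall_zero_iff]
      have h1 := hL k 0 h0 t t.2
      have h2 := Complex.norm_le_abs_re_add_abs_im (u k 0)
      have h3 := norm_sub_norm_le (u k t) (u k 0)
      linarith [hR k 0, him k]
    · refine Metric.equicontinuous_of_continuity_modulus _ hlim _ ?_
      rintro x y ⟨_, k, rfl⟩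
      have hxy : |(x : ℝ) - y| ≤ τ := by
        rw [abs_le]
        constructor <;> linarith [x.2.1, x.2.2, y.2.1, y.2.2]
      have := hmod k y x hxy
      rw [Subtype.dist_eq, Real.dist_eq, abs_abs, dist_eq_norm]
      exact this
  obtain ⟨g, -, σ, hσ, hg⟩ := hcomp.tendsto_subseq (x := f)
    fun k => subset_closure (Set.mem_range_self k)
  have hIcc : ∀ t : Set.Icc 0 τ, Tendsto (fun k => u (σ k) t) atTop (𝓝 (g t)) := fun t =>
    ((continuous_eval_const t).tendsto g).comp hg
  have hex : ∀ t, ∃ ℓ, Tendsto (fun k => u (σ k) t) atTop (𝓝 ℓ) := by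
    intro t
    set s := toIcoMod hτ 0 t with hs
    have hsI : s ∈ Set.Icc 0 τ := by
      have := toIcoMod_mem_Ico hτ 0 t
      rw [zero_add] at this
      exact ⟨this.1, this.2.le⟩
    have hstep : ∀ k, u k t = u k s + (t / τ - s / τ) * (n * (Real.pi * Complex.I)) := by
      intro k
      have hτ' : (τ : ℂ) ≠ 0 := by exact_mod_cast hτ.ne'
      have hper : Function.Periodic
          (fun r : ℝ => u k r - r / τ * (n * (Real.pi * Complex.I))) τ := by
        intro r
        simp only [(hu k).add_half r]
        push_cast
        field_simp
        ring
      have h1 := hper.sub_zsmul_eq (x := t) (toIcoDiv hτ 0 t)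
      have h2 : t - toIcoDiv hτ 0 t • τ = s := rfl
      simp only [h2] at h1
      linear_combination -h1
    simp_rw [hstep]
    exact ⟨_, (hIcc ⟨s, hsI⟩).add_const _⟩
  choose W hW using hex
  refine ⟨σ, W, hσ, ?_, hW⟩
  have hWmod : ∀ s t, |t - s| ≤ τ → ‖W t - W s‖ ≤ C * √|t - s| := fun s t hst =>
    le_of_tendsto ((hW t).sub (hW s)).norm (Eventually.of_forall fun k => hmod _ s t hst)
  refine continuous_iff_continuousAt.2 fun s => ?_
  rw [ContinuousAt, tendsto_iff_norm_sub_tendsto_zero]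
  have hsub : Tendsto (fun t => t - s) (𝓝 s) (𝓝 0) := by
    simpa using (continuous_sub_right s).tendsto s
  refine squeeze_zero' (Eventually.of_forall fun _ => norm_nonneg _) ?_ (hlim.comp hsub)
  have h1 : ∀ᶠ t in 𝓝 s, |t - s| < τ := by
    filter_upwards [Metric.ball_mem_nhds s hτ] with t ht
    rwa [Metric.mem_ball, Real.dist_eq] at ht
  filter_upwards [h1] with t ht using hWmod s t ht.le

/-- Adding a multiple of `2πi` makes `Im w 0` at most `π` in absolute value. -/
lemma IsLogPath.exists_normalized {τ : ℝ} {n : ℤ} {w : ℝ → ℂ} (hw : IsLogPath τ n w) :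
    ∃ w₁, IsLogPath τ n w₁ ∧ |(w₁ 0).im| ≤ Real.pi ∧
      ∀ t, Complex.exp (w₁ t) = Complex.exp (w t) := by
  refine ⟨_, hw.add_const (Complex.log (Complex.exp (w 0)) - w 0), ?_, fun t => ?_⟩
  · rw [add_sub_cancel, Complex.log_im]
    exact Complex.abs_arg_le_pi _
  · rw [Complex.exp_add, Complex.exp_sub, Complex.exp_log (Complex.exp_ne_zero _),
      div_self (Complex.exp_ne_zero _), mul_one]

lemma manevAction_nonneg {μ b τ : ℝ} (hμ : 1 < μ) (hb : 0 < b) (hτ : 0 < τ) (q : ℝ → ℂ) :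
    0 ≤ manevAction μ b τ q :=
  intervalIntegral.integral_nonneg hτ.le fun t _ =>
    add_nonneg (by positivity) (manevU_nonneg hμ hb _)

open Filter Topology in
/-- A minimizing sequence for the action on antiperiodic loops of winding number `n` that converges
pointwise to a continuous limit. -/
lemma exists_minimizing_seq {μ b τ : ℝ} {n : ℤ} (hμ : 1 < μ) (hb : 0 < b) (hτ : 0 < τ)
    (hn : Odd n) :
    ∃ (m R : ℝ) (u : ℕ → ℝ → ℂ) (W : ℝ → ℂ),
      (∀ w, IsLogPath τ n w → m ≤ manevAction μ b τ fun t => Complex.exp (w t)) ∧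
      (∀ k, IsLogPath τ n (u k)) ∧ (∀ k t, |(u k t).re| ≤ R) ∧
      Tendsto (fun k => manevAction μ b τ fun t => Complex.exp (u k t)) atTop (𝓝 m) ∧
      Continuous W ∧ ∀ t, Tendsto (fun k => u k t) atTop (𝓝 (W t)) := by
  set S : Set ℝ := {A | ∃ w, IsLogPath τ n w ∧ |(w 0).im| ≤ Real.pi ∧
    manevAction μ b τ (fun t => Complex.exp (w t)) = A} with hS
  have hbdd : BddBelow S := ⟨0, by
    rintro _ ⟨w, -, -, rfl⟩
    exact manevAction_nonneg hμ hb hτ _⟩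
  have hmem : ∀ w, IsLogPath τ n w → manevAction μ b τ (fun t => Complex.exp (w t)) ∈ S := by
    intro w hw
    obtain ⟨w₁, h1, h2, h3⟩ := hw.exists_normalized
    exact ⟨w₁, h1, h2, by simp only [h3]⟩
  have hne : S.Nonempty := by
    refine ⟨_, hmem (fun t => ((t / τ : ℝ) : ℂ) * (n * (Real.pi * Complex.I))) ⟨?_, fun t => ?_⟩⟩
    · exact (Complex.ofRealCLM.contDiff.comp (contDiff_id.div_const τ)).mul contDiff_const
    · have hτ' : (τ : ℂ) ≠ 0 := by exact_mod_cast hτ.ne'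
      push_cast
      field_simp
  obtain ⟨A, hanti, hA, hAS⟩ := exists_seq_tendsto_sInf hne hbdd
  choose v hv1 hv2 hv3 using hAS
  have hvM : ∀ k, manevAction μ b τ (fun t => Complex.exp (v k t)) ≤ A 0 := fun k => by
    rw [hv3]
    exact hanti (Nat.zero_le k)
  obtain ⟨R, L, hRL⟩ := IsLogPath.exists_bounds hμ hb hτ hn (A 0)
  obtain ⟨σ, W, hσ, hWc, hW⟩ := exists_tendsto_of_action_le hμ hb hτ hn hv1 hvM hv2
  refine ⟨sInf S, R, fun k => v (σ k), W, fun w hw => csInf_le hbdd (hmem w hw),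
    fun k => hv1 _, fun k => (hRL _ (hv1 _) (hvM _)).1, ?_, hWc, hW⟩
  simp_rw [hv3]
  exact hA.comp hσ.tendsto_atTop

/-! ### The Euler-Lagrange equation of the limit -/

section EulerLagrange

open Filter Topology

variable {μ b τ : ℝ}

lemma continuous_manevU_comp (hμ : 1 < μ) {p : ℝ → ℂ} (hp : Continuous p) (h0 : ∀ t, p t ≠ 0) :
    Continuous fun t => manevU μ b (p t) :=
  continuous_iff_continuousAt.2 fun t =>
    ContinuousAt.comp (f := p) (continuousAt_manevU hμ (h0 t)) hp.continuousAt

lemma continuous_manevGrad_comp (hμ : 1 < μ) {p : ℝ → ℂ} (hp : Continuous p)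
    (h0 : ∀ t, p t ≠ 0) : Continuous fun t => manevGrad μ b (p t) :=
  continuous_iff_continuousAt.2 fun t =>
    ContinuousAt.comp (f := p) (continuousAt_manevGrad hμ (h0 t)) hp.continuousAt

lemma tendsto_integral_manevU (hμ : 1 < μ) (hb : 0 < b) {r : ℝ} (hr : 0 < r) {p : ℕ → ℝ → ℂ}
    {P : ℝ → ℂ} (hp : ∀ k, Continuous (p k)) (hpr : ∀ k t, r ≤ ‖p k t‖) (hPr : ∀ t, r ≤ ‖P t‖)
    (hlim : ∀ t, Tendsto (fun k => p k t) atTop (𝓝 (P t))) :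
    Tendsto (fun k => ∫ t in (0 : ℝ)..τ, manevU μ b (p k t)) atTop
      (𝓝 (∫ t in (0 : ℝ)..τ, manevU μ b (P t))) := by
  have hne : ∀ {z : ℂ}, r ≤ ‖z‖ → z ≠ 0 := fun h => norm_pos_iff.1 (hr.trans_le h)
  refine intervalIntegral.tendsto_integral_filter_of_dominated_convergence
    (fun _ => 1 / r + b / r ^ 2) (Eventually.of_forall fun k => ?_)
    (Eventually.of_forall fun k => Eventually.of_forall fun t _ => ?_)
    (continuous_const.intervalIntegrable _ _) (Eventually.of_forall fun t _ => ?_)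
  · exact (continuous_manevU_comp hμ (hp k) fun t => hne (hpr k t)).aestronglyMeasurable
  · rw [Real.norm_of_nonneg (manevU_nonneg hμ hb _)]
    exact manevU_le hμ hb hr (hpr k t)
  · exact (continuousAt_manevU hμ (hne (hPr t))).tendsto.comp (hlim t)

/-- The action of a varied loop. The mixed kinetic term is integrated by parts, so that no
derivative of the loop itself appears in the difference. -/
lemma manevAction_add_smul (hμ : 1 < μ) {n : ℤ} (hn : Odd n) {w φ φ' φ'' : ℝ → ℂ}
    (hw : IsLogPath τ n w) (hφ : ∀ t, HasDerivAt φ (φ' t) t)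
    (hφ' : ∀ t, HasDerivAt φ' (φ'' t) t) (hφ'' : Continuous φ'')
    (haφ' : Function.Antiperiodic φ' τ) (ε : ℝ)
    (hne : ∀ t, Complex.exp (w t) + ε • φ t ≠ 0) :
    manevAction μ b τ (fun t => Complex.exp (w t) + ε • φ t) =
      manevAction μ b τ (fun t => Complex.exp (w t)) +
      (-ε * (∫ t in (0 : ℝ)..τ, inner ℝ (Complex.exp (w t)) (φ'' t)) +
        ε ^ 2 * (∫ t in (0 : ℝ)..τ, ‖φ' t‖ ^ 2 / 2) +
        ((∫ t in (0 : ℝ)..τ, manevU μ b (Complex.exp (w t) + ε • φ t)) -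
          ∫ t in (0 : ℝ)..τ, manevU μ b (Complex.exp (w t)))) := by
  have hφc : Continuous φ := continuous_iff_continuousAt.2 fun t => (hφ t).continuousAt
  have hφ'c : Continuous φ' := continuous_iff_continuousAt.2 fun t => (hφ' t).continuousAt
  have hqc : Continuous fun t => Complex.exp (w t) := hw.contDiff_exp.continuous
  have hq : ∀ t, HasDerivAt (fun t => Complex.exp (w t))
      (deriv (fun t => Complex.exp (w t)) t) t := fun t =>
    (hw.contDiff_exp.differentiable one_ne_zero t).hasDerivAt
  have hq'c := hw.continuous_deriv_exp
  have hparts := integral_inner_deriv_add_eq_zero (τ := τ) hq hφ' hq'c hφ''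
    (antiperiodic_exp hn hw.add_half) haφ'
  have hd : ∀ t, deriv (fun t => Complex.exp (w t) + ε • φ t) t =
      deriv (fun t => Complex.exp (w t)) t + ε • φ' t := fun t =>
    ((hq t).add ((hφ t).const_smul ε)).deriv
  have hU1 : Continuous fun t => manevU μ b (Complex.exp (w t) + ε • φ t) :=
    continuous_manevU_comp hμ (hqc.add (hφc.const_smul ε)) hne
  have hU2 : Continuous fun t => manevU μ b (Complex.exp (w t)) :=
    continuous_manevU_comp hμ hqc fun t => Complex.exp_ne_zero _
  set q' := deriv fun t => Complex.exp (w t) with hq'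
  have hin : Continuous fun t => (inner ℝ (q' t) (φ' t) : ℝ) := hq'c.inner hφ'c
  have hk : Continuous fun t => ‖q' t‖ ^ 2 / 2 := by fun_prop
  have hk' : Continuous fun t => ‖φ' t‖ ^ 2 / 2 := by fun_prop
  have hexp : ∀ t, ‖q' t + ε • φ' t‖ ^ 2 / 2 + manevU μ b (Complex.exp (w t) + ε • φ t) =
      ‖q' t‖ ^ 2 / 2 + ε * inner ℝ (q' t) (φ' t) + ε ^ 2 * (‖φ' t‖ ^ 2 / 2) +
        manevU μ b (Complex.exp (w t) + ε • φ t) := by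
    intro t
    rw [norm_add_sq_real, inner_smul_right, norm_smul, mul_pow, Real.norm_eq_abs, sq_abs]
    ring
  have i1 : IntervalIntegrable (fun t => ε * (inner ℝ (q' t) (φ' t) : ℝ))
    MeasureTheory.volume 0 τ := (continuous_const.mul hin).intervalIntegrable _ _
  have i2 : IntervalIntegrable (fun t => ε ^ 2 * (‖φ' t‖ ^ 2 / 2))
    MeasureTheory.volume 0 τ := (continuous_const.mul hk').intervalIntegrable _ _
  have i0 := hk.intervalIntegrable (μ := MeasureTheory.volume) 0 τ
  simp only [manevAction, hd, hexp]
  rw [intervalIntegral.integral_add ((i0.add i1).add i2) (hU1.intervalIntegrable _ _),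
    intervalIntegral.integral_add (i0.add i1) i2, intervalIntegral.integral_add i0 i1,
    intervalIntegral.integral_add i0 (hU2.intervalIntegrable _ _),
    intervalIntegral.integral_const_mul, intervalIntegral.integral_const_mul]
  linear_combination ε * hparts

lemma hasDerivAt_integral_manevU (hμ : 1 < μ) {q φ : ℝ → ℂ} {r ρ B ε₀ : ℝ} (hr : 0 < r)
    (hε₀ : 0 < ε₀) (hq : Continuous q) (hφ : Continuous φ) (hB : ∀ t, ‖φ t‖ ≤ B)
    (hlow : ∀ ε, |ε| < ε₀ → ∀ t, r ≤ ‖q t + ε • φ t‖)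
    (hup : ∀ ε, |ε| < ε₀ → ∀ t, ‖q t + ε • φ t‖ ≤ ρ) :
    HasDerivAt (fun ε : ℝ => ∫ t in (0 : ℝ)..τ, manevU μ b (q t + ε • φ t))
      (∫ t in (0 : ℝ)..τ, inner ℝ (manevGrad μ b (q t)) (φ t)) 0 := by
  have hne : ∀ {z : ℂ}, r ≤ ‖z‖ → z ≠ 0 := fun h => norm_pos_iff.1 (hr.trans_le h)
  have hcomp : IsCompact {z : ℂ | r ≤ ‖z‖ ∧ ‖z‖ ≤ ρ} := by
    refine (isCompact_closedBall (0 : ℂ) ρ).of_isClosed_subset ?_ fun z hz => by simpa using hz.2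
    exact (isClosed_le continuous_const continuous_norm).inter
      (isClosed_le continuous_norm continuous_const)
  obtain ⟨G, hG⟩ := hcomp.exists_bound_of_continuousOn (f := manevGrad μ b)
    fun z hz => (continuousAt_manevGrad hμ (hne hz.1)).continuousWithinAt
  have habs : ∀ ε ∈ Metric.ball (0 : ℝ) ε₀, |ε| < ε₀ := fun ε hε => by simpa using hε
  have hpc : ∀ ε : ℝ, Continuous fun t => q t + ε • φ t := fun ε => hq.add (hφ.const_smul ε)
  have h0 : |(0 : ℝ)| < ε₀ := by simpa using hε₀
  have key := (intervalIntegral.hasDerivAt_integral_of_dominated_loc_of_deriv_le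
    (μ := MeasureTheory.volume) (a := 0) (b := τ)
    (F := fun ε t => manevU μ b (q t + ε • φ t))
    (F' := fun ε t => inner ℝ (manevGrad μ b (q t + ε • φ t)) (φ t)) (x₀ := (0 : ℝ))
    (bound := fun _ => G * B) (Metric.ball_mem_nhds 0 hε₀) ?_ ?_ ?_ ?_
    (continuous_const.intervalIntegrable _ _) ?_).2
  · simpa using key
  · filter_upwards [Metric.ball_mem_nhds (0 : ℝ) hε₀] with ε hε
    exact (continuous_manevU_comp hμ (hpc ε)
      fun t => hne (hlow ε (habs ε hε) t)).aestronglyMeasurable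
  · exact (continuous_manevU_comp hμ (hpc 0) fun t => hne (hlow 0 h0 t)).intervalIntegrable _ _
  · exact ((continuous_manevGrad_comp hμ (hpc 0)
      fun t => hne (hlow 0 h0 t)).inner hφ).aestronglyMeasurable
  · refine Eventually.of_forall fun t _ ε hε => (norm_inner_le_norm _ _).trans ?_
    have h1 := hG (q t + ε • φ t) ⟨hlow ε (habs ε hε) t, hup ε (habs ε hε) t⟩
    exact mul_le_mul h1 (hB t) (norm_nonneg _) ((norm_nonneg _).trans h1)
  · refine Eventually.of_forall fun t _ ε hε => ?_
    have h1 : HasDerivAt (fun ε : ℝ => q t + ε • φ t) (φ t) ε := by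
      simpa using ((hasDerivAt_id ε).smul_const (φ t)).const_add (q t)
    exact hasDerivAt_manevU_comp hμ h1 (hne (hlow ε (habs ε hε) t))

/-- The pointwise limit of a minimizing sequence satisfies the Euler-Lagrange equation weakly. The
difference of the actions of a varied and an unvaried loop is continuous under pointwise convergence
of the loops, so it is nonnegative in the limit, and it vanishes at `ε = 0`. -/
lemma integral_grad_eq_of_minimizing (hμ : 1 < μ) (hb : 0 < b) (hτ : 0 < τ) {n : ℤ} (hn : Odd n)
    {m R : ℝ} {u : ℕ → ℝ → ℂ} {W : ℝ → ℂ}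
    (hm : ∀ w, IsLogPath τ n w → m ≤ manevAction μ b τ fun t => Complex.exp (w t))
    (hu : ∀ k, IsLogPath τ n (u k)) (hR : ∀ k t, |(u k t).re| ≤ R)
    (hum : Tendsto (fun k => manevAction μ b τ fun t => Complex.exp (u k t)) atTop (𝓝 m))
    (hWc : Continuous W) (hW : ∀ t, Tendsto (fun k => u k t) atTop (𝓝 (W t)))
    {φ φ' φ'' : ℝ → ℂ} (hφ : ∀ t, HasDerivAt φ (φ' t) t)
    (hφ' : ∀ t, HasDerivAt φ' (φ'' t) t) (hφ'' : Continuous φ'')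
    (haφ : Function.Antiperiodic φ τ) (haφ' : Function.Antiperiodic φ' τ) :
    (∫ t in (0 : ℝ)..τ, inner ℝ (manevGrad μ b (Complex.exp (W t))) (φ t)) =
      ∫ t in (0 : ℝ)..τ, inner ℝ (Complex.exp (W t)) (φ'' t) := by
  have hφc : Continuous φ := continuous_iff_continuousAt.2 fun t => (hφ t).continuousAt
  have hφ'c : Continuous φ' := continuous_iff_continuousAt.2 fun t => (hφ' t).continuousAt
  have hφcd : ContDiff ℝ 1 φ := by
    rw [contDiff_one_iff_deriv]
    refine ⟨fun t => (hφ t).differentiableAt, ?_⟩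
    rwa [show deriv φ = φ' from funext fun t => (hφ t).deriv]
  obtain ⟨B, hB⟩ := exists_norm_le_of_antiperiodic hτ hφc haφ
  have hB0 : 0 ≤ B := (norm_nonneg _).trans (hB 0)
  set r := Real.exp (-R) / 2 with hr
  have hrpos : 0 < r := by positivity
  set ε₀ := r / (B + 1) with hε₀
  have hε₀pos : 0 < ε₀ := by positivity
  have hWR : ∀ t, |(W t).re| ≤ R := fun t =>
    le_of_tendsto ((Complex.continuous_re.tendsto _).comp (hW t)).abs
      (Eventually.of_forall fun k => hR k t)
  have hlowexp : ∀ z : ℂ, |z.re| ≤ R → 2 * r ≤ ‖Complex.exp z‖ := fun z hz => by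
    rw [Complex.norm_exp, hr, mul_div_cancel₀ _ two_ne_zero]
    exact Real.exp_le_exp.2 (abs_le.1 hz).1
  have hupexp : ∀ z : ℂ, |z.re| ≤ R → ‖Complex.exp z‖ ≤ Real.exp R := fun z hz => by
    rw [Complex.norm_exp]
    exact Real.exp_le_exp.2 (abs_le.1 hz).2
  have hsmall : ∀ ε, |ε| < ε₀ → ∀ t, ‖ε • φ t‖ ≤ r := fun ε hε t => by
    rw [norm_smul, Real.norm_eq_abs]
    calc |ε| * ‖φ t‖ ≤ ε₀ * (B + 1) := by
          gcongr
          linarith [hB t]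
      _ = r := by rw [hε₀]; field_simp
  have hlow : ∀ ε, |ε| < ε₀ → ∀ z : ℂ, |z.re| ≤ R → ∀ t, r ≤ ‖Complex.exp z + ε • φ t‖ := by
    intro ε hε z hz t
    have h1 := norm_sub_le_norm_add (Complex.exp z) (ε • φ t)
    linarith [hlowexp z hz, hsmall ε hε t]
  have hup : ∀ ε, |ε| < ε₀ → ∀ z : ℂ, |z.re| ≤ R → ∀ t,
      ‖Complex.exp z + ε • φ t‖ ≤ Real.exp R + r := fun ε hε z hz t =>
    (norm_add_le _ _).trans (add_le_add (hupexp z hz) (hsmall ε hε t))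
  have hqlim : ∀ t, Tendsto (fun k => Complex.exp (u k t)) atTop (𝓝 (Complex.exp (W t))) :=
    fun t => (Complex.continuous_exp.tendsto _).comp (hW t)
  have hqc : ∀ k, Continuous fun t => Complex.exp (u k t) := fun k =>
    (hu k).contDiff_exp.continuous
  have hQc : Continuous fun t => Complex.exp (W t) := hWc.cexp
  set c := ∫ t in (0 : ℝ)..τ, inner ℝ (Complex.exp (W t)) (φ'' t) with hc
  set d := ∫ t in (0 : ℝ)..τ, ‖φ' t‖ ^ 2 / 2 with hd
  set h : ℝ → ℝ := fun ε => -ε * c + ε ^ 2 * d +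
    ((∫ t in (0 : ℝ)..τ, manevU μ b (Complex.exp (W t) + ε • φ t)) -
      ∫ t in (0 : ℝ)..τ, manevU μ b (Complex.exp (W t))) with hh
  have hclim : Tendsto (fun k => ∫ t in (0 : ℝ)..τ, inner ℝ (Complex.exp (u k t)) (φ'' t)) atTop
      (𝓝 c) := by
    refine intervalIntegral.tendsto_integral_filter_of_dominated_convergence
      (fun t => Real.exp R * ‖φ'' t‖) (Eventually.of_forall fun k => ?_)
      (Eventually.of_forall fun k => Eventually.of_forall fun t _ => ?_)
      ((continuous_const.mul hφ''.norm).intervalIntegrable _ _)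
      (Eventually.of_forall fun t _ => ?_)
    · exact ((hqc k).inner hφ'').aestronglyMeasurable
    · exact (norm_inner_le_norm _ _).trans
        (mul_le_mul_of_nonneg_right (hupexp _ (hR k t)) (norm_nonneg _))
    · exact (hqlim t).inner tendsto_const_nhds
  have hnonneg : ∀ ε, |ε| < ε₀ → 0 ≤ h ε := by
    intro ε hε
    have hlim1 := tendsto_integral_manevU (τ := τ) hμ hb hrpos
      (p := fun k t => Complex.exp (u k t) + ε • φ t) (P := fun t => Complex.exp (W t) + ε • φ t)
      (fun k => (hqc k).add (hφc.const_smul ε)) (fun k t => hlow ε hε _ (hR k t) t)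
      (fun t => hlow ε hε _ (hWR t) t) (fun t => (hqlim t).add_const _)
    have hlim2 := tendsto_integral_manevU (τ := τ) hμ hb hrpos
      (p := fun k t => Complex.exp (u k t)) (P := fun t => Complex.exp (W t)) hqc
      (fun k t => by linarith [hlowexp _ (hR k t)]) (fun t => by linarith [hlowexp _ (hWR t)])
      hqlim
    have hlim := ((hclim.const_mul (-ε)).add_const (ε ^ 2 * d)).add (hlim1.sub hlim2)
    have hzero : Tendsto (fun k => m - manevAction μ b τ fun t => Complex.exp (u k t)) atTop
        (𝓝 0) := by simpa using hum.const_sub m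
    refine le_of_tendsto_of_tendsto' hzero hlim fun k => ?_
    have hcd : ContDiff ℝ 1 fun t => ε • φ t := hφcd.const_smul ε
    have hap : Function.Antiperiodic (fun t => ε • φ t) τ := fun t => by
      simp only [haφ t, smul_neg]
    obtain ⟨w₁, hw₁, hw₁e⟩ := (hu k).exists_exp_eq_add hn hcd hap fun t => by
      linarith [hlowexp _ (hR k t), hsmall ε hε t]
    have h1 := hm w₁ hw₁
    simp only [hw₁e] at h1
    rw [manevAction_add_smul hμ hn (hu k) hφ hφ' hφ'' haφ' ε
      fun t => norm_pos_iff.1 (hrpos.trans_le (hlow ε hε _ (hR k t) t))] at h1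
    linarith
  have hmin : IsLocalMin h 0 := by
    filter_upwards [Metric.ball_mem_nhds (0 : ℝ) hε₀pos] with ε hε
    have h0 : h 0 = 0 := by simp [hh]
    rw [h0]
    exact hnonneg ε (by simpa using hε)
  have hder : HasDerivAt h (-1 * c + ((2 : ℕ) * (0 : ℝ) ^ (2 - 1) * d) +
      ∫ t in (0 : ℝ)..τ, inner ℝ (manevGrad μ b (Complex.exp (W t))) (φ t)) 0 :=
    (((hasDerivAt_id (0 : ℝ)).neg.mul_const c).add ((hasDerivAt_pow 2 (0 : ℝ)).mul_const d)).add
      ((hasDerivAt_integral_manevU hμ hrpos hε₀pos hQc hφc hB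
        (fun ε hε t => hlow ε hε _ (hWR t) t)
        (fun ε hε t => hup ε hε _ (hWR t) t)).sub_const _)
  have := hmin.hasDerivAt_eq_zero hder
  rw [Nat.add_one_sub_one, pow_one, mul_zero, zero_mul] at this
  linarith

/-- Existence of a smooth antiperiodic solution of `q̈ = ∇U(q)` with prescribed odd winding. -/
lemma exists_antiperiodic_solution (hμ : 1 < μ) (hb : 0 < b) (hτ : 0 < τ) {n : ℤ} (hn : Odd n) :
    ∃ W p : ℝ → ℂ, Continuous W ∧ (∀ t, W (t + τ) = W t + n * (Real.pi * Complex.I)) ∧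
      Function.Antiperiodic p τ ∧ (∀ t, HasDerivAt (fun t => Complex.exp (W t)) (p t) t) ∧
      ∀ t, HasDerivAt p (manevGrad μ b (Complex.exp (W t))) t := by
  obtain ⟨m, R, u, W, hm, hu, hR, hum, hWc, hW⟩ := exists_minimizing_seq hμ hb hτ hn
  have hWa : ∀ t, W (t + τ) = W t + n * (Real.pi * Complex.I) := fun t =>
    tendsto_nhds_unique (hW (t + τ)) (by
      simp_rw [fun k => (hu k).add_half t]
      exact (hW t).add_const _)
  have hqc : Continuous fun t => Complex.exp (W t) := hWc.cexp
  have haq := antiperiodic_exp hn hWa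
  have hgc : Continuous fun t => manevGrad μ b (Complex.exp (W t)) :=
    continuous_manevGrad_comp hμ hqc fun t => Complex.exp_ne_zero _
  have hag : Function.Antiperiodic (fun t => manevGrad μ b (Complex.exp (W t))) τ := fun t => by
    have h := haq t
    simp only at h ⊢
    rw [h, manevGrad_neg]
  have heq := eq_antiPrim_antiPrim hτ hqc hgc haq hag
    fun φ φ' φ'' hφ hφ' hφ'' haφ haφ' =>
      integral_grad_eq_of_minimizing hμ hb hτ hn hm hu hR hum hWc hW hφ hφ' hφ'' haφ haφ'
  refine ⟨W, _, hWc, hWa, antiperiodic_antiPrim hgc hag, fun t => ?_, hasDerivAt_antiPrim hgc⟩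
  rw [heq]
  exact hasDerivAt_antiPrim (continuous_antiPrim hgc) t

end EulerLagrange

/-! ### Return to the Hamiltonian system -/

lemma neg_deriv_manevH_x {μ b x y px py : ℝ} (hμ : 1 < μ) (h : (⟨x, y⟩ : ℂ) ≠ 0) :
    -deriv (fun s => manevH μ b s y px py) x = (manevGrad μ b ⟨x, y⟩).re := by
  have h1 : HasDerivAt (fun s : ℝ => (⟨x, y⟩ + ((s - x : ℝ) : ℂ) : ℂ)) 1 x :=
    (((hasDerivAt_id x).sub_const x).ofReal_comp).const_add _
  have h2 := hasDerivAt_manevU_comp (b := b) hμ h1 (by simpa using h)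
  have h3 : (fun s => manevH μ b s y px py) = fun s =>
      (px ^ 2 + py ^ 2) / 2 - manevU μ b (⟨x, y⟩ + ((s - x : ℝ) : ℂ)) := by
    funext s
    simp [manevH, manevU, anisoSq]
    ring
  rw [h3, (h2.const_sub _).deriv]
  simp [Complex.inner]

lemma neg_deriv_manevH_y {μ b x y px py : ℝ} (hμ : 1 < μ) (h : (⟨x, y⟩ : ℂ) ≠ 0) :
    -deriv (fun s => manevH μ b x s px py) y = (manevGrad μ b ⟨x, y⟩).im := by
  have h1 : HasDerivAt (fun s : ℝ => (⟨x, y⟩ + ((s - y : ℝ) : ℂ) * Complex.I : ℂ))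
      (1 * Complex.I) y :=
    ((((hasDerivAt_id y).sub_const y).ofReal_comp).mul_const _).const_add _
  have h2 := hasDerivAt_manevU_comp (b := b) hμ h1 (by simpa using h)
  have h3 : (fun s => manevH μ b x s px py) = fun s =>
      (px ^ 2 + py ^ 2) / 2 - manevU μ b (⟨x, y⟩ + ((s - y : ℝ) : ℂ) * Complex.I) := by
    funext s
    simp [manevH, manevU, anisoSq]
    ring
  rw [h3, (h2.const_sub _).deriv]
  simp [Complex.inner]

theorem theorem6 (μ b : ℝ) (hμ : 1 < μ) (hb : 0 < b) (T : ℝ) (hT : 0 < T)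
    (n : ℤ) (hn : ∃ k : ℤ, n = 4 * k + 1) :
    ∃ γ : ℝ → PhasePoint,
      IsManevSolution μ b γ ∧ Function.Periodic γ T ∧ IsS3Symmetric T γ ∧
        HasWindingNumber T γ n := by
  have hodd : Odd n := by
    obtain ⟨k, rfl⟩ := hn
    exact ⟨2 * k, by ring⟩
  obtain ⟨W, p, hWc, hWa, hp, hq', hp'⟩ :=
    exists_antiperiodic_solution (b := b) hμ hb (half_pos hT) hodd
  have hq := antiperiodic_exp hodd hWa
  set q : ℝ → ℂ := fun t => Complex.exp (W t) with hqdef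
  have hq0 : ∀ t, q t ≠ 0 := fun t => Complex.exp_ne_zero _
  have hS3 : IsS3Symmetric T fun t => ⟨(q t).re, (q t).im, (p t).re, (p t).im⟩ := fun t => by
    simp [symS3, hq t, hp t]
  refine ⟨_, ⟨fun t h => hq0 t (Complex.ext h.1 h.2), fun t => ?_, fun t => ?_, fun t => ?_,
    fun t => ?_⟩, fun t => ?_, hS3, ?_⟩
  · exact Complex.reCLM.hasFDerivAt.comp_hasDerivAt t (hq' t)
  · exact Complex.imCLM.hasFDerivAt.comp_hasDerivAt t (hq' t)
  · rw [neg_deriv_manevH_x hμ (hq0 t)]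
    exact Complex.reCLM.hasFDerivAt.comp_hasDerivAt t (hp' t)
  · rw [neg_deriv_manevH_y hμ (hq0 t)]
    exact Complex.imCLM.hasFDerivAt.comp_hasDerivAt t (hp' t)
  · have h := hS3 (t + T / 2)
    rw [hS3 t, add_assoc, add_halves] at h
    refine h.trans ?_
    simp [symS3]
  · refine ⟨fun t => Real.exp (W t).re, fun t => (W t).im,
      (Complex.continuous_im.comp hWc).continuousOn, fun t _ => ⟨Real.exp_pos _, ?_, ?_⟩, ?_⟩
    · exact Complex.exp_re _
    · exact Complex.exp_im _
    · have h1 := hWa 0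
      have h2 := hWa (T / 2)
      rw [zero_add] at h1
      rw [add_halves, h1] at h2
      simp only [h2]
      simp
      ring
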